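/- Let $X$ be the graph with vertex set $\mathbb{Z}^2$ in which two vertices are adjacent if and only if their $\ell_1$-distance is $1$. For $A\subset\mathbb{Z}^2$ let $\partial A$ be the set of vertices outside $A$ that are adjacent to a vertex of $A$. A finite set $A\subset\mathbb{Z}^2$ is *minimal* if $|\partial A|\le|\partial C|$ for every $C\subset\mathbb{Z}^2$ with $|C|=|A|$. The *excess* of a finite set $A$ is $$\mathrm{Exc}(A)=\max\bigl\{\,|A|-|B| \;\bigm|\; B\subset\mathbb{Z}^2 \text{ is minimal and } |\partial B|=|\partial A|\,\bigr\}.$$ For $\alpha,\beta\in\mathbb{N}=\{0,1,2,\dots\}$ let $$B(\alpha,\beta)=\{(x,y)\in\mathbb{Z}^2 \mid 0\le y-x\le\alpha,\ 0\le y+x\le\beta\},$$ and for even $\alpha,\beta\in\mathbb{N}$ let $$\hat B(\alpha,\beta)=\{(x,y)\in\mathbb{Z}^2 \mid 0\le y-x\le\alpha,\ -1\le y+x\le\beta-1\}.$$ **Theorem.** Let $\alpha,\beta\in\mathbb{N}$, $r=\frac{\alpha+\beta}{2}$ and $k=\frac{|\beta-\alpha|}{2}$. 1. Suppose that $\beta$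 is even if $\alpha=0$, and that $\alpha$ is even if $\beta=0$. Then the maximum defining $\mathrm{Exc}(B(\alpha,\beta))$ exists and $$\mathrm{Exc}\bigl(B(\alpha,\beta)\bigr)=\left\lfloor\frac{\lfloor r\rfloor-k^2}{2}\right\rfloor .$$ Moreover, $B(\alpha,\beta)$ is minimal if and only if $k^2\le\lfloor r\rfloor$. 2. Suppose that $\alpha$ and $\beta$ are even and positive. Then the maximum defining $\mathrm{Exc}(\hat B(\alpha,\beta))$ exists and $$\mathrm{Exc}\bigl(\hat B(\alpha,\beta)\bigr)=\frac{r-k^2-2}{2}.$$ Moreover, $\hat B(\alpha,\beta)$ is minimal if and only if $k^2+2\le r$. -/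

import Mathlib

/-- The planar integer lattice `ℤ²`, with an edge between any two vertices at `ℓ₁`-distance one. -/
def latticeGraph : SimpleGraph (ℤ × ℤ) where
  Adj p q := |p.1 - q.1| + |p.2 - q.2| = 1
  symm := ⟨fun p q h => by rwa [abs_sub_comm q.1 p.1, abs_sub_comm q.2 p.2]⟩
  loopless := ⟨fun p h => by simp at h⟩

/-- The vertex boundary `∂A`: the vertices outside `A` that are adjacent to a vertex of `A`. -/
def vertexBoundary {V : Type*} (G : SimpleGraph V) (A : Set V) : Set V :=
  {u | u ∉ A ∧ ∃ v ∈ A, G.Adj u v}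

/-- A finite set of lattice points is minimal if its vertex boundary is of least size among all
sets with the same number of vertices. -/
def IsMinimalSet (A : Set (ℤ × ℤ)) : Prop :=
  A.Finite ∧ ∀ C : Set (ℤ × ℤ), C.Finite → C.ncard = A.ncard →
    (vertexBoundary latticeGraph A).ncard ≤ (vertexBoundary latticeGraph C).ncard

/-- The differences `|A| - |B|`, where `B` runs over the minimal sets with `|∂A| = |∂B|`. -/
def excessSet (A : Set (ℤ × ℤ)) : Set ℤ :=
  {e | ∃ B : Set (ℤ × ℤ), IsMinimalSet B ∧
    (vertexBoundary latticeGraph A).ncard = (vertexBoundary latticeGraph B).ncard ∧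
    e = (A.ncard : ℤ) - (B.ncard : ℤ)}

/-- The excess of a finite set: the largest element of `excessSet A` (when there is one). -/
noncomputable def excess (A : Set (ℤ × ℤ)) : ℤ := sSup (excessSet A)

/-- The points `(x, y)` with `a ≤ y - x ≤ b` and `c ≤ y + x ≤ d`. -/
def latticeBox (a b c d : ℤ) : Set (ℤ × ℤ) :=
  {p | a ≤ p.2 - p.1 ∧ p.2 - p.1 ≤ b ∧ c ≤ p.2 + p.1 ∧ p.2 + p.1 ≤ d}

/-- The standard box `B(α, β)`. -/
def stdBox (α β : ℕ) : Set (ℤ × ℤ) := latticeBox 0 α 0 β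

/-- The standard box `B̂(α, β)`, used for even `α` and `β`. -/
def stdBoxHat (α β : ℕ) : Set (ℤ × ℤ) := latticeBox 0 α (-1) (β - 1)

/-! Let M(d) = ⌊((d - 2)² + 4)/8⌋. A nonempty finite set with d boundary points has at most M(d)
points (`eight_mul_ncard_le`). Cut it into columns: every row through a point of a column leaves the
set on both sides, and every column contains two boundary points. So a column with f boundary points
to its left has at most min(f, d - 2 - f) points, and the values f of different columns differ by at
least 2. Near-square boxes attain M(d) for d ≥ 4, d ≠ 5, and deleting rightmost points reaches every
smaller size. Hence, for s ≠ 1, a set with s + 4 boundary points is minimal iff it has more than M(s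
+ 3) points. The size M(s + 3) + 1 does occur, so the excess is |A| - M(s + 3) - 1
(`isGreatest_excessSet`). Counting the points of a box and of its boundary leaves arithmetic based
on 4αβ = (α + β)² - (β - α)². -/

/-! ### Boundaries of finite sets -/

/-- The vertex boundary of a finite set of lattice points is finite. -/
theorem vertexBoundary_finite {A : Set (ℤ × ℤ)} (hA : A.Finite) :
    (vertexBoundary latticeGraph A).Finite := by
  refine (hA.biUnion (t := fun p => Set.Icc (p.1 - 1, p.2 - 1) (p.1 + 1, p.2 + 1))
    (fun p _ => Set.finite_Icc _ _)).subset ?_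
  rintro u ⟨-, v, hv, huv⟩
  simp only [Set.mem_iUnion]
  refine ⟨v, hv, ?_⟩
  simp only [latticeGraph] at huv
  have h1 := abs_nonneg (u.1 - v.1)
  have h2 := abs_nonneg (u.2 - v.2)
  have h3 := abs_le.1 (show |u.1 - v.1| ≤ 1 by omega)
  have h4 := abs_le.1 (show |u.2 - v.2| ≤ 1 by omega)
  simp only [Set.mem_Icc, Prod.le_def]
  omega

/-- Walking from a point of a finite set in a coordinate direction, one meets its boundary. -/
theorem exists_add_nsmul_mem_vertexBoundary {A : Set (ℤ × ℤ)} (hA : A.Finite) {p : ℤ × ℤ}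
    (hp : p ∈ A) {e : ℤ × ℤ} (he : |e.1| + |e.2| = 1) :
    ∃ t : ℕ, p + (t + 1) • e ∈ vertexBoundary latticeGraph A := by
  by_contra! h
  have key : ∀ t : ℕ, p + t • e ∈ A := by
    intro t
    induction t with
    | zero => simpa using hp
    | succ t ih =>
      by_contra hn
      refine h t ⟨hn, _, ih, ?_⟩
      simpa [latticeGraph, add_mul] using he
  refine Set.infinite_of_injective_forall_mem (f := fun t : ℕ => p + t • e) ?_ key hA
  intro s t hst
  have h1 : (s : ℤ) * e.1 = t * e.1 := by simpa using congrArg Prod.fst hst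
  have h2 : (s : ℤ) * e.2 = t * e.2 := by simpa using congrArg Prod.snd hst
  by_cases h0 : e.1 = 0
  · have : e.2 ≠ 0 := by
      rintro h0'
      simp [h0, h0'] at he
    exact_mod_cast mul_right_cancel₀ this h2
  · exact_mod_cast mul_right_cancel₀ h0 h1

/-- Deleting a rightmost point from a finite set does not enlarge its vertex boundary. -/
theorem exists_sdiff_singleton_ncard_vertexBoundary_le {A : Set (ℤ × ℤ)} (hA : A.Finite)
    (hne : A.Nonempty) :
    ∃ p ∈ A, (vertexBoundary latticeGraph (A \ {p})).ncard ≤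
      (vertexBoundary latticeGraph A).ncard := by
  obtain ⟨p, hp, hmax⟩ := hA.exists_maximalFor (fun q : ℤ × ℤ => q.1) A hne
  have hmax' : ∀ q ∈ A, q.1 ≤ p.1 := fun q hq => by
    rcases le_total q.1 p.1 with h | h
    · exact h
    · exact hmax hq h
  refine ⟨p, hp, ?_⟩
  -- Only `p` can join the boundary, and `w` leaves it, since `p` is its sole neighbour in `A`.
  set w : ℤ × ℤ := (p.1 + 1, p.2) with hw
  have hfin := vertexBoundary_finite hA
  have hwA : w ∈ vertexBoundary latticeGraph A := by
    refine ⟨fun h => ?_, p, hp, by simp [latticeGraph, hw]⟩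
    have := hmax' w h
    simp [hw] at this
  have hsub : vertexBoundary latticeGraph (A \ {p}) ⊆
      insert p (vertexBoundary latticeGraph A \ {w}) := by
    rintro u ⟨hu, v, ⟨hvA, hvp⟩, huv⟩
    by_cases hup : u = p
    · exact Or.inl hup
    refine Or.inr ⟨⟨fun h => hu ⟨h, hup⟩, v, hvA, huv⟩, ?_⟩
    rintro rfl
    apply hvp
    have h1 := hmax' v hvA
    simp only [latticeGraph, hw] at huv
    have h2 := abs_nonneg (p.2 - v.2)
    rw [abs_of_nonneg (by omega)] at huv
    have h3 : p.2 - v.2 = 0 := abs_eq_zero.1 (by omega)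
    exact Prod.ext (by omega) (by omega)
  calc _ ≤ (insert p (vertexBoundary latticeGraph A \ {w})).ncard :=
        Set.ncard_le_ncard hsub ((hfin.subset Set.sdiff_subset).insert _)
    _ ≤ (vertexBoundary latticeGraph A \ {w}).ncard + 1 := Set.ncard_insert_le _ _
    _ = _ := Set.ncard_sdiff_singleton_add_one hwA hfin

/-- A finite set contains subsets of every smaller size with no larger vertex boundary. -/
theorem exists_ncard_eq_vertexBoundary_le {A : Set (ℤ × ℤ)} (hA : A.Finite) {n : ℕ}
    (hn : n ≤ A.ncard) :
    ∃ C : Set (ℤ × ℤ), C.Finite ∧ C.ncard = n ∧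
      (vertexBoundary latticeGraph C).ncard ≤ (vertexBoundary latticeGraph A).ncard := by
  induction hn using Nat.decreasingInduction with
  | self => exact ⟨A, hA, rfl, le_rfl⟩
  | of_succ m hm ih =>
    obtain ⟨C, hC, hcard, hle⟩ := ih
    obtain ⟨p, hp, hpC⟩ := exists_sdiff_singleton_ncard_vertexBoundary_le hC
      (Set.nonempty_of_ncard_ne_zero (by omega))
    refine ⟨C \ {p}, hC.subset Set.sdiff_subset, ?_, hpC.trans hle⟩
    have := Set.ncard_sdiff_singleton_add_one hp hC
    omega

/-! ### The isoperimetric inequality -/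

/-- Four times the sum of positive integers at mutual distance at least two and all less than `X`
is at most `X ^ 2`. -/
theorem four_mul_sum_le_sq {ι : Type*} [DecidableEq ι] (f : ι → ℤ) (S : Finset ι) (X : ℤ)
    (hX : 0 ≤ X)
    (hpos : ∀ x ∈ S, 1 ≤ f x) (hlt : ∀ x ∈ S, f x + 1 ≤ X)
    (hsep : ∀ x ∈ S, ∀ y ∈ S, x ≠ y → f x + 2 ≤ f y ∨ f y + 2 ≤ f x) :
    4 * ∑ x ∈ S, f x ≤ X ^ 2 := by
  induction hc : S.card generalizing S X with
  | zero =>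
    rw [Finset.card_eq_zero.1 hc]
    simpa using sq_nonneg X
  | succ n ih =>
    obtain ⟨m, hm, hmax⟩ := S.exists_max_image f (Finset.card_pos.1 (by omega))
    have h := ih (S.erase m) (f m - 1) (by linarith [hpos m hm])
      (fun x hx => hpos x (Finset.mem_of_mem_erase hx))
      (fun x hx => by
        obtain ⟨hne, hxS⟩ := Finset.mem_erase.1 hx
        have h1 := hsep x hxS m hm hne
        have h2 := hmax x hxS
        omega)
      (fun x hx y hy => hsep x (Finset.mem_of_mem_erase hx) y (Finset.mem_of_mem_erase hy))
      (by rw [Finset.card_erase_of_mem hm]; omega)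
    have h1 := hlt m hm
    have h2 := hpos m hm
    -- With M = `f m`, induction gives 4M + (M - 1)² = (M + 1)² ≤ X².
    rw [← Finset.add_sum_erase S f hm]
    nlinarith

/-- Integers `f x` at mutual distance at least two, inside an interval `[0, B]`, have distances to
the complement of the interval with sum at most `(B ^ 2 + 4) / 8`. -/
theorem eight_mul_sum_le_sq_add_four {ι : Type*} [DecidableEq ι] (a f : ι → ℤ) (S : Finset ι)
    (B : ℤ) (hB : 0 ≤ B) (hpos : ∀ x ∈ S, 1 ≤ a x) (hl : ∀ x ∈ S, a x ≤ f x)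
    (hr : ∀ x ∈ S, a x ≤ B - f x)
    (hsep : ∀ x ∈ S, ∀ y ∈ S, x ≠ y → f x + 2 ≤ f y ∨ f y + 2 ≤ f x) :
    8 * ∑ x ∈ S, a x ≤ B ^ 2 + 4 := by
  -- Bound the two halves of the interval separately, measuring from the nearer end.
  have key : ∀ X Y : ℤ, 0 ≤ X → 0 ≤ Y → 2 * X ^ 2 + 2 * Y ^ 2 ≤ B ^ 2 + 4 →
      (∀ x ∈ S, f x ≤ B / 2 → f x + 1 ≤ X) →
      (∀ x ∈ S, B / 2 < f x → B - f x + 1 ≤ Y) → 8 * ∑ x ∈ S, a x ≤ B ^ 2 + 4 := by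
    intro X Y hX hY hXY h1 h2
    have e1 := four_mul_sum_le_sq f (S.filter fun x => f x ≤ B / 2) X hX
      (fun x hx => by
        have hx := (Finset.mem_filter.1 hx).1
        linarith [hpos x hx, hl x hx])
      (fun x hx => h1 x (Finset.mem_filter.1 hx).1 (Finset.mem_filter.1 hx).2)
      (fun x hx y hy => hsep x (Finset.mem_filter.1 hx).1 y (Finset.mem_filter.1 hy).1)
    have e2 := four_mul_sum_le_sq (fun x => B - f x) (S.filter fun x => ¬ f x ≤ B / 2) Y hY
      (fun x hx => by
        have hx := (Finset.mem_filter.1 hx).1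
        linarith [hpos x hx, hr x hx])
      (fun x hx => h2 x (Finset.mem_filter.1 hx).1 (not_le.1 (Finset.mem_filter.1 hx).2))
      (fun x hx y hy hxy => by
        have := hsep x (Finset.mem_filter.1 hx).1 y (Finset.mem_filter.1 hy).1 hxy
        omega)
    have s1 : ∑ x ∈ S with f x ≤ B / 2, a x ≤ ∑ x ∈ S with f x ≤ B / 2, f x :=
      Finset.sum_le_sum fun x hx => hl x (Finset.mem_filter.1 hx).1
    have s2 : ∑ x ∈ S with ¬ f x ≤ B / 2, a x ≤ ∑ x ∈ S with ¬ f x ≤ B / 2, (B - f x) :=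
      Finset.sum_le_sum fun x hx => hr x (Finset.mem_filter.1 hx).1
    rw [← Finset.sum_filter_add_sum_filter_not S (fun x => f x ≤ B / 2)]
    linarith
  obtain ⟨t, ht⟩ : ∃ t, t = B / 2 := ⟨_, rfl⟩
  rw [← ht] at key
  have hBt : B = 2 * t ∨ B = 2 * t + 1 := by omega
  by_cases hmid : ∃ x ∈ S, f x = t
  -- If t is a value, the next one above it is at least t + 2, which shrinks Y. For B = 2t the bound
  -- is sharp: 2(t + 1)² + 2(t - 1)² = B² + 4.
  · obtain ⟨m, hm, hft⟩ := hmid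
    have hm1 := hpos m hm
    have hm2 := hl m hm
    have hs : ∀ x ∈ S, t < f x → t + 2 ≤ f x := fun x hx hxt => by
      have := hsep x hx m hm (by rintro rfl; omega)
      omega
    refine key (t + 1) (B - t - 1) (by omega) (by omega) ?_ (fun x hx h => by omega)
      (fun x hx h => by have := hs x hx h; omega)
    rcases hBt with rfl | rfl <;> nlinarith
  · refine key t (B - t) (by omega) (by omega) ?_ (fun x hx h => ?_) (fun x hx h => by omega)
    · rcases hBt with rfl | rfl <;> nlinarith
    · have : f x ≠ t := fun h => hmid ⟨x, hx, h⟩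
      omega

/-- The vertex-isoperimetric inequality in the planar integer lattice. -/
theorem eight_mul_ncard_le {A : Set (ℤ × ℤ)} (hA : A.Finite) (hne : A.Nonempty) :
    4 ≤ (vertexBoundary latticeGraph A).ncard ∧
    8 * (A.ncard : ℤ) ≤ ((vertexBoundary latticeGraph A).ncard - 2 : ℤ) ^ 2 + 4 := by
  have hD := vertexBoundary_finite hA
  have exit := fun p hp e he => exists_add_nsmul_mem_vertexBoundary hA (p := p) hp (e := e) he
  rw [Set.ncard_eq_toFinset_card _ hA, Set.ncard_eq_toFinset_card _ hD]
  simp only [← hA.mem_toFinset, ← hD.mem_toFinset] at exit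
  replace hne : hA.toFinset.Nonempty := by simpa using hne
  generalize hA.toFinset = F at *
  generalize hD.toFinset = D at *
  clear hA hD A
  -- Points of one column lie in distinct rows, and each row contains an exit point to the left.
  have hleft : ∀ x, (F.filter fun p => p.1 = x).card ≤ (D.filter fun p => p.1 < x).card := by
    intro x
    rw [← Finset.card_image_of_injOn (f := Prod.snd) (s := F.filter fun p => p.1 = x)]
    · refine (Finset.card_le_card ?_).trans (Finset.card_image_le (f := Prod.snd))
      intro y hy
      simp only [Finset.mem_image, Finset.mem_filter] at hy ⊢
      obtain ⟨p, ⟨hp, rfl⟩, rfl⟩ := hy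
      obtain ⟨t, ht⟩ := exit p hp (-1, 0) (by simp)
      exact ⟨_, ⟨ht, by simp; omega⟩, by simp⟩
    · intro p hp q hq h
      simp only [Finset.coe_filter, Set.mem_ofPred_eq] at hp hq
      exact Prod.ext (hp.2.trans hq.2.symm) h
  have hright : ∀ x, (F.filter fun p => p.1 = x).card ≤ (D.filter fun p => x < p.1).card := by
    intro x
    rw [← Finset.card_image_of_injOn (f := Prod.snd) (s := F.filter fun p => p.1 = x)]
    · refine (Finset.card_le_card ?_).trans (Finset.card_image_le (f := Prod.snd))
      intro y hy
      simp only [Finset.mem_image, Finset.mem_filter] at hy ⊢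
      obtain ⟨p, ⟨hp, rfl⟩, rfl⟩ := hy
      obtain ⟨t, ht⟩ := exit p hp (1, 0) (by simp)
      exact ⟨_, ⟨ht, by simp⟩, by simp⟩
    · intro p hp q hq h
      simp only [Finset.coe_filter, Set.mem_ofPred_eq] at hp hq
      exact Prod.ext (hp.2.trans hq.2.symm) h
  have hmid : ∀ x ∈ F.image Prod.fst, 2 ≤ (D.filter fun p => p.1 = x).card := by
    intro x hx
    obtain ⟨p, hp, rfl⟩ := Finset.mem_image.1 hx
    obtain ⟨s, hs⟩ := exit p hp (0, 1) (by simp)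
    obtain ⟨t, ht⟩ := exit p hp (0, -1) (by simp)
    refine Finset.one_lt_card.2 ⟨_, Finset.mem_filter.2 ⟨hs, by simp⟩, _,
      Finset.mem_filter.2 ⟨ht, by simp⟩, fun h => ?_⟩
    have := congrArg Prod.snd h
    simp at this
    omega
  have hsplit : ∀ x, D.card = (D.filter fun p => p.1 < x).card +
      (D.filter fun p => p.1 = x).card + (D.filter fun p => x < p.1).card := by
    intro x
    rw [Finset.card_eq_sum_ones]
    simp only [Finset.card_filter, ← Finset.sum_add_distrib]
    refine Finset.sum_congr rfl fun p _ => ?_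
    split_ifs <;> omega
  have hsep : ∀ x ∈ F.image Prod.fst, ∀ y, x < y →
      (D.filter fun p => p.1 < x).card + 2 ≤ (D.filter fun p => p.1 < y).card := by
    intro x hx y hxy
    have h1 := hmid x hx
    have h2 : (D.filter fun p => p.1 < x).card + (D.filter fun p => p.1 = x).card ≤
        (D.filter fun p => p.1 < y).card := by
      simp only [Finset.card_filter, ← Finset.sum_add_distrib]
      refine Finset.sum_le_sum fun p _ => ?_
      split_ifs <;> omega
    omega
  have hpos : ∀ x ∈ F.image Prod.fst, 1 ≤ (F.filter fun p => p.1 = x).card := by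
    intro x hx
    obtain ⟨p, hp, rfl⟩ := Finset.mem_image.1 hx
    exact Finset.card_pos.2 ⟨p, Finset.mem_filter.2 ⟨hp, rfl⟩⟩
  have hfour : 4 ≤ D.card := by
    obtain ⟨p, hp⟩ := hne
    have hx := Finset.mem_image_of_mem Prod.fst hp
    have := hmid _ hx
    have := hpos _ hx
    have := hleft p.1
    have := hright p.1
    have := hsplit p.1
    omega
  refine ⟨hfour, ?_⟩
  rw [Finset.card_eq_sum_card_image Prod.fst F, Nat.cast_sum]
  -- Here B = |D| - 2: at least two boundary points lie in the column itself.
  refine eight_mul_sum_le_sq_add_four _ (fun x => ((D.filter fun p => p.1 < x).card : ℤ)) _ _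
    (by omega) (fun x hx => by exact_mod_cast hpos x hx)
    (fun x hx => by exact_mod_cast hleft x) (fun x hx => ?_) (fun x hx y hy hxy => ?_)
  · have := hmid x hx
    have := hright x
    have := hsplit x
    omega
  · rcases lt_or_gt_of_ne hxy with h | h
    · left; exact_mod_cast hsep x hx y h
    · right; exact_mod_cast hsep y hy x h

/-! ### Counting points and boundary points of boxes -/

/-- The number of lattice points on a diagonal segment. -/
theorem ncard_diagonalSegment (a v : ℤ) (m : ℕ) :
    {p : ℤ × ℤ | a ≤ p.2 - p.1 ∧ p.2 - p.1 ≤ a + m ∧ p.2 + p.1 = v}.Finite ∧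
    ({p : ℤ × ℤ | a ≤ p.2 - p.1 ∧ p.2 - p.1 ≤ a + m ∧ p.2 + p.1 = v}.ncard : ℤ) =
      (v - a) / 2 + 1 - (v - a - m + 1) / 2 := by
  have h : {p : ℤ × ℤ | a ≤ p.2 - p.1 ∧ p.2 - p.1 ≤ a + m ∧ p.2 + p.1 = v} =
      (((Finset.Icc ((v - a - m + 1) / 2) ((v - a) / 2)).image fun x => (x, v - x) :
        Finset (ℤ × ℤ)) : Set (ℤ × ℤ)) := by
    ext ⟨x, y⟩
    simp only [Set.mem_ofPred_eq, Finset.coe_image, Set.mem_image, Finset.mem_coe, Finset.mem_Icc,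
      Prod.mk.injEq]
    constructor
    · rintro ⟨h1, h2, h3⟩
      exact ⟨x, by omega, rfl, by omega⟩
    · rintro ⟨z, h1, rfl, rfl⟩
      omega
  rw [h]
  refine ⟨Finset.finite_toSet _, ?_⟩
  rw [Set.ncard_coe_finset, Finset.card_image_of_injective _ fun x y hxy => (Prod.ext_iff.1 hxy).1,
    Int.card_Icc]
  omega

/-- The number of lattice points in a box. -/
theorem ncard_latticeBox (a c : ℤ) (m n : ℕ) :
    (latticeBox a (a + m) c (c + n - 1)).Finite ∧
    2 * ((latticeBox a (a + m) c (c + n - 1)).ncard : ℤ) = (m + 1) * n +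
      (if m % 2 = 0 ∧ n % 2 = 1 then (if (a + c) % 2 = 0 then 1 else -1) else 0) := by
  -- Add one diagonal y + x = c + n at a time. For even m these have m/2 + 1 and m/2 points
  -- alternately, whence the correction for odd n.
  induction n with
  | zero =>
    have : latticeBox a (a + m) c (c + (0 : ℕ) - 1) = ∅ := by
      ext p
      simp only [latticeBox, Set.mem_ofPred_eq, Set.mem_empty_iff_false, iff_false]
      push_cast
      omega
    rw [this]
    simp
  | succ n ih =>
    obtain ⟨hf, hc⟩ := ih
    obtain ⟨hf', hc'⟩ := ncard_diagonalSegment a (c + n) m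
    have hunion : latticeBox a (a + m) c (c + (n + 1 : ℕ) - 1) =
        latticeBox a (a + m) c (c + n - 1) ∪
          {p : ℤ × ℤ | a ≤ p.2 - p.1 ∧ p.2 - p.1 ≤ a + m ∧ p.2 + p.1 = c + n} := by
      ext p
      simp only [latticeBox, Set.mem_ofPred_eq, Set.mem_union]
      push_cast
      omega
    have hdisj : Disjoint (latticeBox a (a + m) c (c + n - 1))
        {p : ℤ × ℤ | a ≤ p.2 - p.1 ∧ p.2 - p.1 ≤ a + m ∧ p.2 + p.1 = c + n} := by
      rw [Set.disjoint_left]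
      intro p h1 h2
      simp only [latticeBox, Set.mem_ofPred_eq] at h1 h2
      omega
    rw [hunion]
    refine ⟨hf.union hf', ?_⟩
    rw [Set.ncard_union_eq hdisj hf hf']
    push_cast
    rw [mul_add, hc, hc']
    have : ((m : ℤ) + 1) * (n + 1) = (m + 1) * n + m + 1 := by ring
    rw [this]
    generalize ((m : ℤ) + 1) * n = P
    split_ifs <;> omega

/-- The boundary of a box, together with the box, is the box enlarged by one on each side, unless
the box is so thin that its enlargement contains points with no neighbour in it. -/
theorem vertexBoundary_latticeBox {a b c d : ℤ} (hab : a ≤ b) (hcd : c ≤ d)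
    (h1 : a = b → (a + c) % 2 = 0 ∧ (a + d) % 2 = 0)
    (h2 : c = d → (a + c) % 2 = 0 ∧ (b + c) % 2 = 0) :
    vertexBoundary latticeGraph (latticeBox a b c d) =
      latticeBox (a - 1) (b + 1) (c - 1) (d + 1) \ latticeBox a b c d := by
  ext ⟨x, y⟩
  constructor
  · rintro ⟨hn, ⟨z, w⟩, hv, hadj⟩
    refine ⟨?_, hn⟩
    simp only [latticeGraph, latticeBox, Set.mem_ofPred_eq] at hadj hv ⊢
    -- A unit step changes each of y - x and y + x by exactly one.
    rcases abs_cases (x - z) with h | h <;> rcases abs_cases (y - w) with h' | h' <;> omega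
  · rintro ⟨hb, hn⟩
    refine ⟨hn, ?_⟩
    have key : (x + 1, y) ∈ latticeBox a b c d ∨ (x - 1, y) ∈ latticeBox a b c d ∨
        (x, y + 1) ∈ latticeBox a b c d ∨ (x, y - 1) ∈ latticeBox a b c d := by
      simp only [latticeBox, Set.mem_ofPred_eq] at hb hn ⊢
      omega
    rcases key with h | h | h | h
    · exact ⟨_, h, by simp [latticeGraph]⟩
    · exact ⟨_, h, by simp [latticeGraph]⟩
    · exact ⟨_, h, by simp [latticeGraph]⟩
    · exact ⟨_, h, by simp [latticeGraph]⟩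

/-- The number of boundary points of a box that is not too thin. -/
theorem ncard_vertexBoundary_latticeBox (a c : ℤ) (m n : ℕ)
    (h1 : m = 0 → (a + c) % 2 = 0 ∧ n % 2 = 0) (h2 : n = 0 → (a + c) % 2 = 0 ∧ m % 2 = 0) :
    (vertexBoundary latticeGraph (latticeBox a (a + m) c (c + n))).ncard = m + n + 4 := by
  rw [vertexBoundary_latticeBox (by omega) (by omega) (by omega) (by omega)]
  obtain ⟨-, hc⟩ := ncard_latticeBox a c m (n + 1)
  obtain ⟨hf', hc'⟩ := ncard_latticeBox (a - 1) (c - 1) (m + 2) (n + 3)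
  rw [show c + ((n + 1 : ℕ) : ℤ) - 1 = c + n by push_cast; ring] at hc
  rw [show c - 1 + ((n + 3 : ℕ) : ℤ) - 1 = c + n + 1 by push_cast; ring,
    show a - 1 + ((m + 2 : ℕ) : ℤ) = a + m + 1 by push_cast; ring] at hc' hf'
  have hsub : latticeBox a (a + m) c (c + n) ⊆
      latticeBox (a - 1) (a + m + 1) (c - 1) (c + n + 1) := by
    intro p hp
    simp only [latticeBox, Set.mem_ofPred_eq] at hp ⊢
    omega
  have := Set.ncard_sdiff_add_ncard_of_subset hsub hf'
  push_cast at hc hc'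
  -- The enlargement preserves all parities, so the corrections cancel in the difference.
  have e : ((m : ℤ) + 2 + 1) * (n + 3) = (m + 1) * (n + 1) + 2 * m + 2 * n + 8 := by ring
  rw [e] at hc'
  generalize ((m : ℤ) + 1) * (n + 1) = P at *
  split_ifs at hc hc' <;> omega

theorem stdBox_finite (α β : ℕ) : (stdBox α β).Finite := by
  have := (ncard_latticeBox 0 0 α (β + 1)).1
  simpa [stdBox] using this

theorem ncard_stdBox (α β : ℕ) :
    2 * ((stdBox α β).ncard : ℤ) =
      (α + 1) * (β + 1) + (if α % 2 = 0 ∧ β % 2 = 0 then 1 else 0) := by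
  have := (ncard_latticeBox 0 0 α (β + 1)).2
  simp only [zero_add, Nat.cast_add, Nat.cast_one, add_sub_cancel_right] at this
  rw [stdBox, this]
  split_ifs <;> omega

theorem ncard_vertexBoundary_stdBox (α β : ℕ) (h1 : α = 0 → Even β) (h2 : β = 0 → Even α) :
    (vertexBoundary latticeGraph (stdBox α β)).ncard = α + β + 4 := by
  have := ncard_vertexBoundary_latticeBox 0 0 α β (fun h => ⟨rfl, Nat.even_iff.1 (h1 h)⟩)
    (fun h => ⟨rfl, Nat.even_iff.1 (h2 h)⟩)
  simpa [stdBox] using this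

theorem stdBoxHat_finite (α β : ℕ) : (stdBoxHat α β).Finite := by
  have := (ncard_latticeBox 0 (-1) α (β + 1)).1
  rw [show (-1 : ℤ) + ((β + 1 : ℕ) : ℤ) - 1 = β - 1 by push_cast; ring] at this
  simpa [stdBoxHat] using this

theorem ncard_stdBoxHat (α β : ℕ) (hα : Even α) (hβ : Even β) :
    2 * ((stdBoxHat α β).ncard : ℤ) = (α + 1) * (β + 1) - 1 := by
  have := (ncard_latticeBox 0 (-1) α (β + 1)).2
  rw [show (-1 : ℤ) + ((β + 1 : ℕ) : ℤ) - 1 = β - 1 by push_cast; ring] at this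
  rw [Nat.even_iff] at hα hβ
  rw [if_pos ⟨hα, by omega⟩] at this
  simpa [stdBoxHat, sub_eq_add_neg] using this

theorem ncard_vertexBoundary_stdBoxHat (α β : ℕ) (hα : 0 < α) (hβ : 0 < β) :
    (vertexBoundary latticeGraph (stdBoxHat α β)).ncard = α + β + 4 := by
  have := ncard_vertexBoundary_latticeBox 0 (-1) α β (by omega) (by omega)
  rw [show (-1 : ℤ) + (β : ℤ) = β - 1 by ring] at this
  simpa [stdBoxHat] using this

/-! ### Extremal sizes and minimal sets -/

/-- The upper bound of the isoperimetric inequality is attained for every boundary size that some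
nonempty set has. -/
theorem exists_ncard_eq_vertexBoundary_le_add_four {s n : ℕ} (hs : s ≠ 1)
    (hn : 8 * n ≤ (s + 2) ^ 2 + 4) :
    ∃ C : Set (ℤ × ℤ), C.Finite ∧ C.ncard = n ∧
      (vertexBoundary latticeGraph C).ncard ≤ s + 4 := by
  have hfin := stdBox_finite (s / 2) ((s + 1) / 2)
  have hcard := ncard_stdBox (s / 2) ((s + 1) / 2)
  have hbd := ncard_vertexBoundary_stdBox (s / 2) ((s + 1) / 2)
    (fun h => by rw [Nat.even_iff]; omega) (fun h => by rw [Nat.even_iff]; omega)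
  rw [show s / 2 + (s + 1) / 2 + 4 = s + 4 by omega] at hbd
  rw [← hbd]
  apply exists_ncard_eq_vertexBoundary_le hfin
  rcases Nat.even_or_odd' s with ⟨t, rfl | rfl⟩
  · rw [show 2 * t / 2 = t by omega, show (2 * t + 1) / 2 = t by omega] at *
    have e1 : ((t : ℤ) + 1) * (t + 1) = t * t + 2 * t + 1 := by ring
    have e2 : (2 * t + 2) ^ 2 = 4 * (t * t) + 8 * t + 4 := by ring
    rw [e1] at hcard
    rw [e2] at hn
    zify at hn ⊢
    rcases Nat.even_or_odd' t with ⟨w, hw | hw⟩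
    · rw [if_pos (by omega)] at hcard
      omega
    · have e3 : (t : ℤ) * t = 2 * (2 * w * w + 2 * w) + 1 := by subst hw; push_cast; ring
      rw [if_neg (by omega)] at hcard
      omega
  · rw [show (2 * t + 1) / 2 = t by omega, show (2 * t + 1 + 1) / 2 = t + 1 by omega] at *
    rw [if_neg (by omega)] at hcard
    zify at hn ⊢
    push_cast at hcard
    obtain ⟨w, hw⟩ := Int.even_mul_succ_self ((t : ℤ) + 1)
    have e2 : (2 * (t : ℤ) + 1 + 2) ^ 2 = 4 * ((t + 1) * (t + 1 + 1)) + 1 := by ring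
    rw [e2, hw] at hn
    rw [hw] at hcard
    omega

/-- The excess of a set is the difference between its size and that of the smallest minimal set with
the same boundary size, which exceeds the isoperimetric bound for smaller boundaries by one. -/
theorem isGreatest_excessSet {A : Set (ℤ × ℤ)} (hA : A.Finite) {s : ℕ}
    (hs : s ≠ 1) (hbd : (vertexBoundary latticeGraph A).ncard = s + 4) :
    IsGreatest (excessSet A) (A.ncard - (((s : ℤ) + 1) ^ 2 + 4) / 8 - 1) ∧
    (IsMinimalSet A ↔ 0 ≤ (A.ncard : ℤ) - (((s : ℤ) + 1) ^ 2 + 4) / 8 - 1) := by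
  obtain ⟨m, hm⟩ : ∃ m : ℕ, m = ((s + 1) ^ 2 + 4) / 8 := ⟨_, rfl⟩
  have hm' : (((s : ℤ) + 1) ^ 2 + 4) / 8 = m := by rw [hm]; push_cast; rfl
  rw [hm']
  -- sets with a smaller boundary have at most `m` points
  have large : ∀ C : Set (ℤ × ℤ), C.Finite → m + 1 ≤ C.ncard →
      s + 4 ≤ (vertexBoundary latticeGraph C).ncard := by
    intro C hC hmC
    by_contra! hlt
    obtain ⟨h4, h⟩ := eight_mul_ncard_le hC (Set.nonempty_of_ncard_ne_zero (by omega))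
    have : ((vertexBoundary latticeGraph C).ncard - 2 : ℤ) ^ 2 ≤ ((s : ℤ) + 1) ^ 2 :=
      pow_le_pow_left₀ (by omega) (by omega) 2
    omega
  have small : ∀ n ≤ m, ∃ C : Set (ℤ × ℤ), C.Finite ∧ C.ncard = n ∧
      (vertexBoundary latticeGraph C).ncard ≤ s + 3 := by
    intro n hn
    -- For s = 2 the preceding boundary size 5 is the exceptional one, so a set with at most 4
    -- boundary points is used instead.
    rcases Nat.lt_or_ge s 3 with h | h
    · have hs' : s = 0 ∨ s = 2 := by omega
      rcases hs' with rfl | rfl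
      · exact ⟨∅, Set.finite_empty, by simp at hm ⊢; omega, by simp [vertexBoundary]⟩
      · obtain ⟨C, h1, h2, h3⟩ := exists_ncard_eq_vertexBoundary_le_add_four (s := 0) (n := n)
          (by omega) (by norm_num at hm ⊢; omega)
        exact ⟨C, h1, h2, by omega⟩
    · obtain ⟨t, rfl⟩ : ∃ t, s = t + 1 := ⟨s - 1, by omega⟩
      exact exists_ncard_eq_vertexBoundary_le_add_four (s := t) (n := n) (by omega)
        (by rw [show t + 2 = t + 1 + 1 by rfl]; omega)
  have minimal : ∀ C : Set (ℤ × ℤ), C.Finite →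
      (vertexBoundary latticeGraph C).ncard = s + 4 → (IsMinimalSet C ↔ m + 1 ≤ C.ncard) := by
    intro C hC hCs
    refine ⟨fun h => ?_, fun h => ⟨hC, fun E hE hEC => ?_⟩⟩
    · by_contra! hlt
      obtain ⟨E, h1, h2, h3⟩ := small C.ncard (by omega)
      have := h.2 E h1 h2
      omega
    · rw [hCs]
      exact large E hE (by omega)
  refine ⟨⟨?_, ?_⟩, ?_⟩
  · have hbound : 8 * (m + 1) ≤ (s + 2) ^ 2 + 4 := by
      have h1 : (s + 2) ^ 2 = (s + 1) ^ 2 + 2 * s + 3 := by ring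
      rcases Nat.lt_or_ge s 3 with h | h
      · have hs' : s = 0 ∨ s = 2 := by omega
        rcases hs' with rfl | rfl <;> norm_num at hm ⊢ <;> omega
      · rcases Nat.even_or_odd' s with ⟨t, rfl | rfl⟩
        · obtain ⟨w, hw⟩ := Nat.even_mul_succ_self t
          have h2 : (2 * t + 1) ^ 2 = 4 * (t * (t + 1)) + 1 := by ring
          omega
        · rcases Nat.even_or_odd' t with ⟨w, hw | hw⟩
          · have h2 : (2 * t + 1 + 1) ^ 2 = 8 * (2 * w * w + 2 * w) + 4 := by subst hw; ring
            omega
          · have h2 : (2 * t + 1 + 1) ^ 2 = 8 * (2 * w * w + 4 * w + 2) := by subst hw; ring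
            omega
    obtain ⟨C, h1, h2, h3⟩ := exists_ncard_eq_vertexBoundary_le_add_four hs hbound
    have h4 := large C h1 h2.ge
    have h5 := le_antisymm h3 h4
    exact ⟨C, (minimal C h1 h5).2 h2.ge, by omega, by rw [h2]; push_cast; ring⟩
  · rintro e ⟨B, hB, hAB, rfl⟩
    have := (minimal B hB.1 (by omega)).1 hB
    omega
  · rw [minimal A hA hbd]
    omega

/-! ### Arithmetic of the excess formulas -/

/-- The excess of a standard box as a function of its side lengths. -/
theorem excess_stdBox_aux (α β : ℕ) :
    ((stdBox α β).ncard : ℤ) - (((α + β : ℕ) + 1 : ℤ) ^ 2 + 4) / 8 - 1 =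
      (4 * ((α + β) / 2 : ℕ) - ((β : ℤ) - α) ^ 2) / 8 := by
  have hcard := ncard_stdBox α β
  generalize (stdBox α β).ncard = N at *
  rcases Nat.even_or_odd' α with ⟨i, rfl | rfl⟩ <;> rcases Nat.even_or_odd' β with ⟨j, rfl | rfl⟩
  · rw [if_pos (by omega)] at hcard
    push_cast at hcard ⊢
    -- Evenness of n(n + 1) fixes the odd square modulo 8, hence the rounding; the rest is linear in
    -- ij.
    obtain ⟨w, hw⟩ := Int.even_mul_succ_self ((i : ℤ) + j)
    have h1 : ((2 * i + 2 * j + 1 : ℤ)) ^ 2 = 4 * ((i + j) * (i + j + 1)) + 1 := by ring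
    have h2 : ((2 * j - 2 * i : ℤ)) ^ 2 =
      4 * ((i + j) * (i + j + 1)) - 4 * i - 4 * j - 16 * (i * j) := by ring
    have h3 : (2 * i + 1 : ℤ) * (2 * j + 1) = 4 * (i * j) + 2 * i + 2 * j + 1 := by ring
    rw [h1, h2, hw]
    rw [h3] at hcard
    generalize (i : ℤ) * j = P at *
    omega
  · rw [if_neg (by omega)] at hcard
    push_cast at hcard ⊢
    have h1 : ((2 * i + (2 * j + 1) + 1 : ℤ)) ^ 2 = 4 * ((i + j + 1) ^ 2) := by ring
    have h2 : ((2 * j + 1 - 2 * i : ℤ)) ^ 2 =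
      4 * ((i + j + 1) ^ 2) - 8 * i - 4 * (i + j) - 3 - 16 * (i * j) := by ring
    have h3 : (2 * i + 1 : ℤ) * (2 * j + 1 + 1) = 4 * (i * j) + 4 * i + 2 * j + 2 := by ring
    rw [h1, h2]
    rw [h3] at hcard
    have h4 : ((i + j + 1 : ℤ) ^ 2) % 2 = (i + j + 1) % 2 := by
      obtain ⟨w, hw⟩ := Int.even_mul_succ_self ((i : ℤ) + j)
      have : (i + j + 1 : ℤ) ^ 2 = (i + j) * (i + j + 1) + (i + j + 1) := by ring
      omega
    generalize (i : ℤ) * j = P at *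
    generalize (i + j + 1 : ℤ) ^ 2 = Q at *
    omega
  · rw [if_neg (by omega)] at hcard
    push_cast at hcard ⊢
    have h1 : ((2 * i + 1 + 2 * j + 1 : ℤ)) ^ 2 = 4 * ((i + j + 1) ^ 2) := by ring
    have h2 : ((2 * j - (2 * i + 1) : ℤ)) ^ 2 =
      4 * ((i + j + 1) ^ 2) - 8 * j - 4 * (i + j) - 3 - 16 * (i * j) := by ring
    have h3 : (2 * i + 1 + 1 : ℤ) * (2 * j + 1) = 4 * (i * j) + 4 * j + 2 * i + 2 := by ring
    rw [h1, h2]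
    rw [h3] at hcard
    have h4 : ((i + j + 1 : ℤ) ^ 2) % 2 = (i + j + 1) % 2 := by
      obtain ⟨w, hw⟩ := Int.even_mul_succ_self ((i : ℤ) + j)
      have : (i + j + 1 : ℤ) ^ 2 = (i + j) * (i + j + 1) + (i + j + 1) := by ring
      omega
    generalize (i : ℤ) * j = P at *
    generalize (i + j + 1 : ℤ) ^ 2 = Q at *
    omega
  · rw [if_neg (by omega)] at hcard
    push_cast at hcard ⊢
    obtain ⟨w, hw⟩ := Int.even_mul_succ_self ((i : ℤ) + j + 1)
    have h1 : ((2 * i + 1 + (2 * j + 1) + 1 : ℤ)) ^ 2 =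
      4 * ((i + j + 1) * (i + j + 1 + 1)) + 1 := by ring
    have h2 : ((2 * j + 1 - (2 * i + 1) : ℤ)) ^ 2 =
      4 * ((i + j + 1) * (i + j + 1 + 1)) - 12 * i - 12 * j - 8 - 16 * (i * j) := by ring
    have h3 : (2 * i + 1 + 1 : ℤ) * (2 * j + 1 + 1) = 4 * (i * j) + 4 * i + 4 * j + 4 := by ring
    rw [h1, h2, hw]
    rw [h3] at hcard
    generalize (i : ℤ) * j = P at *
    omega

/-- Eight times the excess of a shifted standard box as a function of its side lengths. -/
theorem excess_stdBoxHat_aux (α β : ℕ) (hα : Even α) (hβ : Even β) :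
    8 * (((stdBoxHat α β).ncard : ℤ) - (((α + β : ℕ) + 1 : ℤ) ^ 2 + 4) / 8 - 1) =
      2 * (α + β) - ((β : ℤ) - α) ^ 2 - 8 := by
  have hcard := ncard_stdBoxHat α β hα hβ
  generalize (stdBoxHat α β).ncard = N at *
  obtain ⟨i, rfl⟩ := hα.two_dvd
  obtain ⟨j, rfl⟩ := hβ.two_dvd
  push_cast at hcard ⊢
  obtain ⟨w, hw⟩ := Int.even_mul_succ_self ((i : ℤ) + j)
  have h1 : ((2 * i + 2 * j + 1 : ℤ)) ^ 2 = 4 * ((i + j) * (i + j + 1)) + 1 := by ring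
  have h2 : ((2 * j - 2 * i : ℤ)) ^ 2 =
    4 * ((i + j) * (i + j + 1)) - 4 * i - 4 * j - 16 * (i * j) := by ring
  have h3 : (2 * i + 1 : ℤ) * (2 * j + 1) = 4 * (i * j) + 2 * i + 2 * j + 1 := by ring
  rw [h1, h2, hw]
  rw [h3] at hcard
  generalize (i : ℤ) * j = P at *
  omega

theorem mainTheorem2 (α β : ℕ) (r k : ℚ)
    (hr : r = ((α : ℚ) + (β : ℚ)) / 2) (hk : k = |(β : ℚ) - (α : ℚ)| / 2) :
    ((α = 0 → Even β) → (β = 0 → Even α) →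
      IsGreatest (excessSet (stdBox α β)) (excess (stdBox α β)) ∧
      excess (stdBox α β) = ⌊((⌊r⌋ : ℚ) - k ^ 2) / 2⌋ ∧
      (IsMinimalSet (stdBox α β) ↔ k ^ 2 ≤ (⌊r⌋ : ℚ))) ∧
    (Even α → Even β → 0 < α → 0 < β →
      IsGreatest (excessSet (stdBoxHat α β)) (excess (stdBoxHat α β)) ∧
      (excess (stdBoxHat α β) : ℚ) = (r - k ^ 2 - 2) / 2 ∧
      (IsMinimalSet (stdBoxHat α β) ↔ k ^ 2 + 2 ≤ r)) := by
  have hk2 : k ^ 2 = ((β : ℚ) - α) ^ 2 / 4 := by rw [hk, div_pow, sq_abs]; norm_num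
  have hfloor : ⌊r⌋ = (((α + β) / 2 : ℕ) : ℤ) := by
    rw [hr, Int.floor_eq_iff]
    have h1 : 2 * ((α + β) / 2) ≤ α + β := Nat.mul_div_le _ _
    have h2 : α + β < 2 * ((α + β) / 2) + 2 := by omega
    have h1' : (2 * ((α + β) / 2 : ℕ) : ℚ) ≤ α + β := by exact_mod_cast h1
    have h2' : (α + β : ℚ) < 2 * ((α + β) / 2 : ℕ) + 2 := by exact_mod_cast h2
    constructor
    · rw [Int.cast_natCast]
      linarith
    · rw [Int.cast_natCast]
      linarith
  refine ⟨fun h1 h2 => ?_, fun hα hβ h1 h2 => ?_⟩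
  -- The hypotheses on thin boxes exclude exactly the missing boundary size 5.
  · have hs : α + β ≠ 1 := by
      intro h
      have h3 : α = 0 ∨ β = 0 := by omega
      rcases h3 with h3 | h3
      · obtain ⟨t, ht⟩ := h1 h3
        omega
      · obtain ⟨t, ht⟩ := h2 h3
        omega
    obtain ⟨hgr, hmin⟩ := isGreatest_excessSet (stdBox_finite α β) hs
      (ncard_vertexBoundary_stdBox α β h1 h2)
    have he : excess (stdBox α β) = _ := hgr.csSup_eq
    rw [excess_stdBox_aux] at hgr hmin he
    refine ⟨he ▸ hgr, ?_, ?_⟩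
    · rw [he, hk2, hfloor]
      -- Integer division by 8 rounds down, so it is the floor for negative excess too.
      refine (Rat.floor_intCast_div_natCast _ 8).symm.trans ?_
      congr 1
      push_cast
      ring
    · rw [hmin, Int.le_ediv_iff_mul_le (by norm_num), zero_mul, sub_nonneg, hk2, hfloor,
        div_le_iff₀ (by norm_num), mul_comm]
      exact_mod_cast Iff.rfl
  · obtain ⟨hgr, hmin⟩ := isGreatest_excessSet (stdBoxHat_finite α β) (by omega)
      (ncard_vertexBoundary_stdBoxHat α β h1 h2)
    have he : excess (stdBoxHat α β) = _ := hgr.csSup_eq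
    have haux := excess_stdBoxHat_aux α β hα hβ
    rw [← he] at hgr hmin haux
    have haux' : 8 * (excess (stdBoxHat α β) : ℚ) = 2 * (α + β) - ((β : ℚ) - α) ^ 2 - 8 := by
      exact_mod_cast haux
    have hval : (excess (stdBoxHat α β) : ℚ) = (r - k ^ 2 - 2) / 2 := by
      rw [hk2, hr]
      linarith
    refine ⟨hgr, hval, ?_⟩
    rw [hmin, ← Int.cast_nonneg_iff (R := ℚ), hval]
    constructor <;> intro h <;> linarith
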